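/- Let $n,p,M\in\mathbb{Z}_{\ge 0}$ and let $A\in\mathbb{R}^{n\times n}$, $C_1,\dots,C_M\in\mathbb{R}^{p\times n}$. Let $\Phi^w\in\mathbb{R}^{n\times n}$ and $\Phi^v_1,\dots,\Phi^v_M\in\mathbb{R}^{p\times p}$ be symmetric positive definite. Let $\mathcal{A}$ be the cone of symmetric positive semidefinite real $n\times n$ matrices, equipped with the metric of the spectral norm $\|\cdot\|$ (the matrix norm induced by the Euclidean vector norm), and let $\preceq$ denote the Loewner order. For $i\in\{1,\dots,M\}$ define the Riccati map $$\rho_i(Q)=\Phi^w+AQA^T-AQC_i^T\left(C_iQC_i^T+\Phi^v_i\right)^{-1}C_iQA^T,\qquad Q\in\mathcal{A}.$$ For a schedule $\sigma:\mathbb{Z}_{\ge 0}\to\{1,\dots,M\}$ let $\Sigma_t^\sigma=\rho_{\sigma(t-1)}\circ\cdots\circ\rho_{\sigma(0)}$ be its composite $t$-step Riccati map (with $\Sigma_0^\sigma=\mathrm{id}$). Call $\sigma$ feasible if for every $\phi\in\mathcal{A}$ there is $\beta<\infty$ such that $\Sigma_t^\sigma(\phi)\preceq\beta I_n$ for all $t\ge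 0$. Corollary (stability under feasible periodic schedules). Let $\sigma$ be a feasible schedule that is periodic with period $N\ge 1$, i.e. $\sigma(t)=\sigma(t+N)$ for all $t\ge 0$. Then $\Sigma_N^\sigma$ maps $\mathcal{A}$ into itself, and the discrete system $\phi_{k+1}=\Sigma_N^\sigma(\phi_k)$, $\phi_0\in\mathcal{A}$, is globally asymptotically stable and locally exponentially stable on $\mathcal{A}$; that is, there is $P\in\mathcal{A}$ with $\Sigma_N^\sigma(P)=P$ such that: 1. (Lyapunov stability) for every $\varepsilon>0$ there is $\delta>0$ such that $\phi_0\in\mathcal{A}$ and $\|\phi_0-P\|<\delta$ imply $\|\phi_k-P\|<\varepsilon$ for all $k\ge 0$; 2. (global attractivity) $\phi_k\to P$ as $k\to\infty$ for every $\phi_0\in\mathcal{A}$; 3. (local exponential stability) there are $r>0$, $c>0$ and $\eta\in(0,1)$ such that $\phi_0\in\mathcal{A}$ and $\|\phi_0-P\|<r$ imply $\|\phi_k-P\|\le c\,\eta^k\,\|\phi_0-P\|$ for all $k\ge 0$. -/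

import Mathlib

open Matrix Filter Topology
open scoped Matrix.Norms.L2Operator

namespace SensorScheduling

/-- The cone `𝒜` of real symmetric positive semidefinite `n × n` matrices. -/
def psdCone (n : ℕ) : Set (Matrix (Fin n) (Fin n) ℝ) :=
  {Q | Q.PosSemidef}

/-- The Riccati map of a sensor with measurement matrix `C` and measurement noise covariance `V`,
for dynamics `A` and process noise covariance `W`:
`ρ(Q) = W + A Q Aᵀ - A Q Cᵀ (C Q Cᵀ + V)⁻¹ C Q Aᵀ`. -/
noncomputable def riccati {n p : ℕ} (A W : Matrix (Fin n) (Fin n) ℝ)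
    (C : Matrix (Fin p) (Fin n) ℝ) (V : Matrix (Fin p) (Fin p) ℝ)
    (Q : Matrix (Fin n) (Fin n) ℝ) : Matrix (Fin n) (Fin n) ℝ :=
  W + A * Q * Aᵀ - A * Q * Cᵀ * (C * Q * Cᵀ + V)⁻¹ * C * Q * Aᵀ

/-- The composite Riccati map `Σ_t^σ = ρ_{σ(t-1)} ∘ ⋯ ∘ ρ_{σ(0)}` of a sensor schedule `σ`. -/
noncomputable def compositeRiccati {n p M : ℕ} (A W : Matrix (Fin n) (Fin n) ℝ)
    (C : Fin M → Matrix (Fin p) (Fin n) ℝ) (V : Fin M → Matrix (Fin p) (Fin p) ℝ)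
    (σ : ℕ → Fin M) : ℕ → Matrix (Fin n) (Fin n) ℝ → Matrix (Fin n) (Fin n) ℝ
  | 0, φ => φ
  | t + 1, φ => riccati A W (C (σ t)) (V (σ t)) (compositeRiccati A W C V σ t φ)

/-- A schedule is feasible if, for every initial covariance `φ` in the cone, there is a real `β`
with `Σ_t^σ(φ) ⪯ β I` for all `t`. -/
def IsFeasible {n p M : ℕ} (A W : Matrix (Fin n) (Fin n) ℝ)
    (C : Fin M → Matrix (Fin p) (Fin n) ℝ) (V : Fin M → Matrix (Fin p) (Fin p) ℝ)
    (σ : ℕ → Fin M) : Prop :=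
  ∀ φ ∈ psdCone n, ∃ β : ℝ, ∀ t : ℕ,
    (β • (1 : Matrix (Fin n) (Fin n) ℝ) - compositeRiccati A W C V σ t φ).PosSemidef

/-- `P` is a globally asymptotically stable equilibrium of the discrete system `x_{k+1} = f(x_k)`
with state space `S`: the state space is invariant, `P` is an equilibrium in it, `P` is Lyapunov
stable, and every trajectory starting in `S` converges to `P`. -/
structure IsGloballyAsymptoticallyStable {E : Type*} [PseudoMetricSpace E]
    (f : E → E) (S : Set E) (P : E) : Prop where
  mapsTo : Set.MapsTo f S S
  mem : P ∈ S
  isFixedPt : f P = P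
  stable : ∀ ε > 0, ∃ δ > 0, ∀ x ∈ S, dist x P < δ → ∀ k : ℕ, dist (f^[k] x) P < ε
  attractive : ∀ x ∈ S, Tendsto (fun k : ℕ => f^[k] x) atTop (𝓝 P)

/-- `P` is a locally exponentially stable equilibrium of the discrete system `x_{k+1} = f(x_k)`
with state space `S`: the state space is invariant, `P` is an equilibrium in it, and trajectories
that start in `S` close enough to `P` converge to `P` at a uniform exponential rate. -/
structure IsLocallyExponentiallyStable {E : Type*} [PseudoMetricSpace E]
    (f : E → E) (S : Set E) (P : E) : Prop where
  mapsTo : Set.MapsTo f S S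
  mem : P ∈ S
  isFixedPt : f P = P
  exp_stable : ∃ r > 0, ∃ c > 0, ∃ η : ℝ, 0 < η ∧ η < 1 ∧
    ∀ x ∈ S, dist x P < r → ∀ k : ℕ, dist (f^[k] x) P ≤ c * η ^ k * dist x P

end SensorScheduling

/-! The Riccati map is a minimum over gains of maps affine in `Q`, attained at the Kalman gain.
Hence it is monotone and strictly subhomogeneous: `X ≤ (1 + s) • Y` gives `ρ X ≤ (1 + s) • ρ Y - s •
W` (`riccati_le_smul_sub`). If `w I ≤ W` and the trajectory of `Y` stays below `β I`, then `W`
dominates `w / β` times that trajectory, so each step shrinks the relative excess `s` by the factor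
`1 - w / β` (`compositeRiccati_le_smul`). On an interval `[a I, b I]` with `a > 0`, relative excess
and norm distance control each other, which gives exponential contraction in norm
(`exists_contraction`). The fixed point is the limit of the orbit of `0`. Attraction is global
because one period lifts every state above `w I`. -/

namespace SensorScheduling

open scoped MatrixOrder

/-! ### Loewner order and its relation to the spectral norm. -/

section LoewnerOrder

variable {m n : Type*} [Finite m] [Fintype n]

theorem conj_mono (B : Matrix m n ℝ) {X Y : Matrix n n ℝ} (h : X ≤ Y) :
    B * X * Bᵀ ≤ B * Y * Bᵀ := by
  have := (Matrix.le_iff.1 h).mul_mul_conjTranspose_same B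
  rw [Matrix.le_iff]
  simpa [Matrix.mul_sub, Matrix.sub_mul, conjTranspose_eq_transpose_of_trivial] using this

theorem conj_nonneg (B : Matrix m n ℝ) {X : Matrix n n ℝ} (h : 0 ≤ X) :
    0 ≤ B * X * Bᵀ := by
  simpa using conj_mono B h

theorem isHermitian_of_nonneg {n : Type*} {X : Matrix n n ℝ} (h : 0 ≤ X) : X.IsHermitian :=
  (Matrix.nonneg_iff_posSemidef.1 h).isHermitian

theorem smul_le_smul_left_of_nonneg {n : Type*} {X Y : Matrix n n ℝ} {a : ℝ} (ha : 0 ≤ a)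
    (h : X ≤ Y) : a • X ≤ a • Y := by
  rw [Matrix.le_iff, ← smul_sub]
  exact (Matrix.le_iff.1 h).smul ha

theorem smul_le_smul_right_of_le {n : Type*} {X : Matrix n n ℝ} {a b : ℝ} (h : a ≤ b)
    (hX : 0 ≤ X) : a • X ≤ b • X := by
  rw [Matrix.le_iff, ← sub_smul]
  exact (Matrix.nonneg_iff_posSemidef.1 hX).smul (sub_nonneg.2 h)

theorem one_nonneg_loewner {n : Type*} [DecidableEq n] : (0 : Matrix n n ℝ) ≤ 1 :=
  Matrix.nonneg_iff_posSemidef.2 Matrix.PosSemidef.one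

variable [DecidableEq n]

theorem exists_pos_smul_one_le {X : Matrix n n ℝ} (hX : X.PosDef) :
    ∃ a : ℝ, 0 < a ∧ a • (1 : Matrix n n ℝ) ≤ X := by
  cases isEmpty_or_nonempty n
  · exact ⟨1, one_pos, (Subsingleton.elim _ _).le⟩
  · obtain ⟨a, ha, h⟩ :=
      (CFC.exists_pos_algebraMap_le_iff (A := Matrix n n ℝ) (a := X)
        hX.isHermitian.isSelfAdjoint).2 fun x hx => by
          rw [hX.isHermitian.spectrum_real_eq_range_eigenvalues] at hx
          obtain ⟨i, rfl⟩ := hx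
          exact hX.eigenvalues_pos i
    exact ⟨a, ha, by rwa [Algebra.algebraMap_eq_smul_one] at h⟩

/-- The spectrum of a Hermitian matrix is bounded by its norm. Together with the converse
`norm_sub_le_of_le_add`, this translates between norm and order estimates. -/
theorem le_add_norm_smul_one {X Y : Matrix n n ℝ} (hX : X.IsHermitian) (hY : Y.IsHermitian) :
    X ≤ Y + ‖X - Y‖ • (1 : Matrix n n ℝ) := by
  have hs : IsSelfAdjoint (X - Y) := (hX.sub hY).isSelfAdjoint
  have h : X - Y ≤ algebraMap ℝ (Matrix n n ℝ) ‖X - Y‖ :=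
    (le_algebraMap_iff_spectrum_le hs).2 fun x hx => by
      cases isEmpty_or_nonempty n
      · simp at hx
      · exact (le_abs_self x).trans
          (IsometricContinuousFunctionalCalculus.norm_spectrum_le (X - Y) hx hs)
  rw [Algebra.algebraMap_eq_smul_one, sub_le_iff_le_add'] at h
  exact h

theorem norm_sub_le_of_le_add {X Y : Matrix n n ℝ} {d : ℝ} (hX : X.IsHermitian)
    (hY : Y.IsHermitian) (hd : 0 ≤ d) (h₁ : X ≤ Y + d • (1 : Matrix n n ℝ))
    (h₂ : Y ≤ X + d • (1 : Matrix n n ℝ)) : ‖X - Y‖ ≤ d := by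
  have hs : IsSelfAdjoint (X - Y) := (hX.sub hY).isSelfAdjoint
  have h₁' : X - Y ≤ algebraMap ℝ (Matrix n n ℝ) d := by
    rw [Algebra.algebraMap_eq_smul_one, sub_le_iff_le_add']
    exact h₁
  have h₂' : algebraMap ℝ (Matrix n n ℝ) (-d) ≤ X - Y := by
    rw [Algebra.algebraMap_eq_smul_one, neg_smul, neg_le, neg_sub, sub_le_iff_le_add']
    exact h₂
  rw [← cfc_id ℝ (X - Y) hs]
  refine norm_cfc_le hd fun x hx => abs_le.2 ⟨?_, ?_⟩
  · exact (algebraMap_le_iff_le_spectrum hs).1 h₂' x hx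
  · exact (le_algebraMap_iff_spectrum_le hs).1 h₁' x hx

end LoewnerOrder

/-! ### One Riccati step as a minimum over gains. -/

section Riccati

variable {n p : ℕ} {A W : Matrix (Fin n) (Fin n) ℝ} {C : Matrix (Fin p) (Fin n) ℝ}
  {V : Matrix (Fin p) (Fin p) ℝ}

theorem posDef_innovation (hV : V.PosDef) {Q : Matrix (Fin n) (Fin n) ℝ} (hQ : 0 ≤ Q) :
    (C * Q * Cᵀ + V).PosDef :=
  Matrix.PosDef.posSemidef_add (Matrix.nonneg_iff_posSemidef.1 (conj_nonneg C hQ)) hV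

/-- The Kalman gain, which minimises the one-step error covariance. -/
noncomputable def kalmanGain (A : Matrix (Fin n) (Fin n) ℝ) (C : Matrix (Fin p) (Fin n) ℝ)
    (V : Matrix (Fin p) (Fin p) ℝ) (Q : Matrix (Fin n) (Fin n) ℝ) : Matrix (Fin n) (Fin p) ℝ :=
  A * Q * Cᵀ * (C * Q * Cᵀ + V)⁻¹

/-- The one-step error covariance of an estimator with gain `K`, in Joseph form. -/
def josephForm (A W : Matrix (Fin n) (Fin n) ℝ) (C : Matrix (Fin p) (Fin n) ℝ)
    (V : Matrix (Fin p) (Fin p) ℝ) (K : Matrix (Fin n) (Fin p) ℝ)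
    (Q : Matrix (Fin n) (Fin n) ℝ) : Matrix (Fin n) (Fin n) ℝ :=
  (A - K * C) * Q * (A - K * C)ᵀ + K * V * Kᵀ + W

/-- Completion of the square in the gain. -/
theorem josephForm_eq (hV : V.PosDef) {Q : Matrix (Fin n) (Fin n) ℝ} (hQ : 0 ≤ Q)
    (K : Matrix (Fin n) (Fin p) ℝ) :
    josephForm A W C V K Q = riccati A W C V Q +
      (K - kalmanGain A C V Q) * (C * Q * Cᵀ + V) * (K - kalmanGain A C V Q)ᵀ := by
  have hS := posDef_innovation (C := C) hV hQ
  have hQt : Qᵀ = Q := isHermitian_of_nonneg hQ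
  have hSt : (C * Q * Cᵀ + V)ᵀ = C * Q * Cᵀ + V := hS.isHermitian
  have hdet : IsUnit (C * Q * Cᵀ + V).det := (Matrix.isUnit_iff_isUnit_det _).1 hS.isUnit
  have hR : riccati A W C V Q = W + A * Q * Aᵀ - kalmanGain A C V Q * (C * Q * Aᵀ) := by
    simp only [riccati, kalmanGain, Matrix.mul_assoc]
  have h₁ : kalmanGain A C V Q * (C * Q * Cᵀ + V) = A * Q * Cᵀ := by
    rw [kalmanGain, Matrix.nonsing_inv_mul_cancel_right _ _ hdet]
  have h₂ : (C * Q * Cᵀ + V) * (kalmanGain A C V Q)ᵀ = C * Q * Aᵀ := by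
    have := congrArg Matrix.transpose h₁
    rwa [Matrix.transpose_mul, hSt, Matrix.transpose_mul, Matrix.transpose_mul, hQt,
      Matrix.transpose_transpose, ← Matrix.mul_assoc] at this
  have h₃ : (K - kalmanGain A C V Q) * (C * Q * Cᵀ + V) * (K - kalmanGain A C V Q)ᵀ =
      K * (C * Q * Cᵀ + V) * Kᵀ - K * (C * Q * Aᵀ) - A * Q * Cᵀ * Kᵀ +
        kalmanGain A C V Q * (C * Q * Aᵀ) := by
    rw [Matrix.sub_mul, h₁, Matrix.transpose_sub, Matrix.mul_sub, Matrix.sub_mul, Matrix.sub_mul,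
      Matrix.mul_assoc K _ (kalmanGain A C V Q)ᵀ, h₂, ← h₁,
      Matrix.mul_assoc (kalmanGain A C V Q) _ (kalmanGain A C V Q)ᵀ, h₂]
    abel
  rw [hR, h₃]
  simp only [josephForm, Matrix.transpose_sub, Matrix.transpose_mul, Matrix.sub_mul,
    Matrix.mul_sub, Matrix.mul_add, Matrix.add_mul, Matrix.mul_assoc]
  abel

theorem riccati_le_josephForm (hV : V.PosDef) {Q : Matrix (Fin n) (Fin n) ℝ} (hQ : 0 ≤ Q)
    (K : Matrix (Fin n) (Fin p) ℝ) : riccati A W C V Q ≤ josephForm A W C V K Q := by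
  rw [josephForm_eq hV hQ]
  exact le_add_of_nonneg_right (conj_nonneg _ (posDef_innovation hV hQ).posSemidef.nonneg)

theorem josephForm_kalmanGain (hV : V.PosDef) {Q : Matrix (Fin n) (Fin n) ℝ} (hQ : 0 ≤ Q) :
    josephForm A W C V (kalmanGain A C V Q) Q = riccati A W C V Q := by
  simp [josephForm_eq hV hQ]

/-- At the optimal gain the Joseph form is `W` plus two positive semidefinite terms. -/
theorem le_riccati (hV : V.PosDef) {Q : Matrix (Fin n) (Fin n) ℝ} (hQ : 0 ≤ Q) :
    W ≤ riccati A W C V Q := by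
  rw [← josephForm_kalmanGain hV hQ, josephForm]
  exact le_add_of_nonneg_left
    (add_nonneg (conj_nonneg _ hQ) (conj_nonneg _ hV.posSemidef.nonneg))

/-- The Riccati map is monotone and subhomogeneous, with a gain controlled by `W`. -/
theorem riccati_le_smul_sub (hV : V.PosDef) {X Y : Matrix (Fin n) (Fin n) ℝ} (hX : 0 ≤ X)
    (hY : 0 ≤ Y) {s : ℝ} (hs : 0 ≤ s) (h : X ≤ (1 + s) • Y) :
    riccati A W C V X ≤ (1 + s) • riccati A W C V Y - s • W := by
  -- The gain optimal for `Y` is merely admissible for `X`, which suffices for an upper bound.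
  set G := kalmanGain A C V Y with hG
  calc riccati A W C V X ≤ josephForm A W C V G X := riccati_le_josephForm hV hX G
    _ ≤ josephForm A W C V G ((1 + s) • Y) := by
        unfold josephForm
        gcongr
        exact conj_mono _ h
    -- The noise terms do not scale with `Q`; this is the source of the gain.
    _ = (1 + s) • josephForm A W C V G Y - s • W - s • (G * V * Gᵀ) := by
        simp only [josephForm, Matrix.mul_smul, Matrix.smul_mul]
        module
    _ ≤ (1 + s) • riccati A W C V Y - s • W := by
        rw [hG, josephForm_kalmanGain hV hY]
        refine sub_le_self _ ?_
        simpa using smul_le_smul_left_of_nonneg hs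
          (conj_nonneg (kalmanGain A C V Y) hV.posSemidef.nonneg)

end Riccati

/-! ### Contraction along a feasible schedule. -/

section Composite

variable {n p M : ℕ} {A W : Matrix (Fin n) (Fin n) ℝ} {C : Fin M → Matrix (Fin p) (Fin n) ℝ}
  {V : Fin M → Matrix (Fin p) (Fin p) ℝ} {σ : ℕ → Fin M}

theorem compositeRiccati_nonneg (hW : W.PosDef) (hV : ∀ i, (V i).PosDef)
    {X : Matrix (Fin n) (Fin n) ℝ} (hX : 0 ≤ X) (t : ℕ) :
    0 ≤ compositeRiccati A W C V σ t X := by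
  induction t with
  | zero => exact hX
  | succ t ih => exact hW.posSemidef.nonneg.trans (le_riccati (hV _) ih)

theorem le_compositeRiccati (hW : W.PosDef) (hV : ∀ i, (V i).PosDef)
    {X : Matrix (Fin n) (Fin n) ℝ} (hX : 0 ≤ X) {t : ℕ} (ht : 1 ≤ t) :
    W ≤ compositeRiccati A W C V σ t X := by
  obtain ⟨t, rfl⟩ := Nat.exists_eq_add_of_le' ht
  exact le_riccati (hV _) (compositeRiccati_nonneg hW hV hX t)

theorem compositeRiccati_mono (hW : W.PosDef) (hV : ∀ i, (V i).PosDef)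
    {X Y : Matrix (Fin n) (Fin n) ℝ} (hX : 0 ≤ X) (h : X ≤ Y) (t : ℕ) :
    compositeRiccati A W C V σ t X ≤ compositeRiccati A W C V σ t Y := by
  induction t with
  | zero => exact h
  | succ t ih =>
    -- Monotonicity is the case `s = 0`.
    simpa [compositeRiccati] using riccati_le_smul_sub (A := A) (W := W) (C := C (σ t)) (hV (σ t))
      (compositeRiccati_nonneg hW hV hX t) (compositeRiccati_nonneg hW hV (hX.trans h) t)
      le_rfl (by simpa using ih)

theorem compositeRiccati_add_period {N : ℕ} (hper : ∀ t, σ t = σ (t + N)) (t : ℕ)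
    (X : Matrix (Fin n) (Fin n) ℝ) :
    compositeRiccati A W C V σ (t + N) X =
      compositeRiccati A W C V σ t (compositeRiccati A W C V σ N X) := by
  induction t with
  | zero => simp [compositeRiccati]
  | succ t ih => rw [Nat.add_right_comm, compositeRiccati, compositeRiccati, ih, ← hper]

theorem iterate_compositeRiccati {N : ℕ} (hper : ∀ t, σ t = σ (t + N)) (k : ℕ)
    (X : Matrix (Fin n) (Fin n) ℝ) :
    (compositeRiccati A W C V σ N)^[k] X = compositeRiccati A W C V σ (k * N) X := by
  induction k generalizing X with
  | zero => simp [compositeRiccati]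
  | succ k ih => rw [Function.iterate_succ_apply, ih, Nat.succ_mul, compositeRiccati_add_period hper]

/-- Contraction of the order interval `[0, (1 + s) Y]` along a bounded trajectory. -/
theorem compositeRiccati_le_smul (hW : W.PosDef) (hV : ∀ i, (V i).PosDef) {w β : ℝ} (hw : 0 ≤ w)
    (hβ : 0 < β) (hwβ : w ≤ β) (hwW : w • 1 ≤ W) {X Y : Matrix (Fin n) (Fin n) ℝ} (hX : 0 ≤ X)
    (hY : 0 ≤ Y) (hYβ : ∀ t, compositeRiccati A W C V σ t Y ≤ β • 1) {s : ℝ} (hs : 0 ≤ s)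
    (h : X ≤ (1 + s) • Y) (t : ℕ) :
    compositeRiccati A W C V σ t X ≤
      (1 + s * (1 - w / β) ^ t) • compositeRiccati A W C V σ t Y := by
  have hη : 0 ≤ 1 - w / β := sub_nonneg.2 (div_le_one_of_le₀ hwβ hβ.le)
  induction t with
  | zero => simpa [compositeRiccati] using h
  | succ t ih =>
    set R := compositeRiccati A W C V σ (t + 1) Y with hR
    have hs' : 0 ≤ s * (1 - w / β) ^ t := by positivity
    have hRW : (w / β) • R ≤ W := by
      refine (smul_le_smul_left_of_nonneg (by positivity) (hYβ (t + 1))).trans ?_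
      rwa [smul_smul, div_mul_cancel₀ _ hβ.ne']
    calc compositeRiccati A W C V σ (t + 1) X
        ≤ (1 + s * (1 - w / β) ^ t) • R - (s * (1 - w / β) ^ t) • W :=
          riccati_le_smul_sub (hV _) (compositeRiccati_nonneg hW hV hX t)
            (compositeRiccati_nonneg hW hV hY t) hs' ih
      _ ≤ (1 + s * (1 - w / β) ^ t) • R - (s * (1 - w / β) ^ t) • (w / β) • R := by
          gcongr
      _ = (1 + s * (1 - w / β) ^ (t + 1)) • R := by
          rw [smul_smul, ← sub_smul, pow_succ]
          ring_nf

/-- Two trajectories starting in a common order interval `[a I, b I]`, `a > 0`, approach each other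
exponentially, at a rate that depends on the interval only. -/
theorem exists_contraction (hW : W.PosDef) (hV : ∀ i, (V i).PosDef)
    (hσ : IsFeasible A W C V σ) {a : ℝ} (ha : 0 < a) (b : ℝ) :
    ∃ c > 0, ∃ η : ℝ, 0 < η ∧ η < 1 ∧ ∀ X Y : Matrix (Fin n) (Fin n) ℝ,
      a • 1 ≤ X → X ≤ b • 1 → a • 1 ≤ Y → Y ≤ b • 1 → ∀ t : ℕ,
        ‖compositeRiccati A W C V σ t X - compositeRiccati A W C V σ t Y‖ ≤
          c * η ^ t * ‖X - Y‖ := by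
  obtain ⟨w, hw, hwW⟩ := exists_pos_smul_one_le hW
  have hbI : (0 : Matrix (Fin n) (Fin n) ℝ) ≤ max b 0 • 1 := by
    simpa using smul_le_smul_left_of_nonneg (le_max_right b 0) one_nonneg_loewner
  obtain ⟨β₀, hβ₀⟩ := hσ (max b 0 • 1) (Matrix.nonneg_iff_posSemidef.1 hbI)
  -- The `w + 1` keeps the rate `1 - w / β` strictly positive.
  set β := max β₀ (w + 1) with hβ
  have hwβ : w < β := (lt_add_one w).trans_le (le_max_right _ _)
  have hβ0 : 0 < β := hw.trans hwβ
  have haI : (0 : Matrix (Fin n) (Fin n) ℝ) ≤ a • 1 := by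
    simpa using smul_le_smul_left_of_nonneg ha.le one_nonneg_loewner
  -- By monotonicity, feasibility at the top of the interval bounds all its trajectories at once.
  have hbd : ∀ Y : Matrix (Fin n) (Fin n) ℝ, 0 ≤ Y → Y ≤ b • 1 →
      ∀ t, compositeRiccati A W C V σ t Y ≤ β • 1 := fun Y hY hYb t =>
    ((compositeRiccati_mono hW hV hY
      (hYb.trans (smul_le_smul_right_of_le (le_max_left b 0) one_nonneg_loewner)) t).trans
      (hβ₀ t)).trans (smul_le_smul_right_of_le (le_max_left _ _) one_nonneg_loewner)
  have hη : 0 < 1 - w / β := sub_pos.2 ((div_lt_one hβ0).2 hwβ)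
  have key : ∀ X Y : Matrix (Fin n) (Fin n) ℝ, 0 ≤ X → a • 1 ≤ Y → Y ≤ b • 1 → ∀ t : ℕ,
      compositeRiccati A W C V σ t X ≤ compositeRiccati A W C V σ t Y +
        (β / a * (1 - w / β) ^ t * ‖X - Y‖) • (1 : Matrix (Fin n) (Fin n) ℝ) := by
    intro X Y hX hY hYb t
    have hY0 := haI.trans hY
    -- Since `Y ≥ a I`, an additive error `d I` costs at most `(d / a) • Y`.
    have h : X ≤ (1 + ‖X - Y‖ / a) • Y := by
      refine (le_add_norm_smul_one (isHermitian_of_nonneg hX)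
        (isHermitian_of_nonneg hY0)).trans ?_
      rw [add_smul, one_smul]
      gcongr
      refine le_trans (le_of_eq ?_) (smul_le_smul_left_of_nonneg
        (div_nonneg (norm_nonneg (X - Y)) ha.le) hY)
      rw [smul_smul, div_mul_cancel₀ _ ha.ne']
    refine (compositeRiccati_le_smul hW hV hw.le hβ0 hwβ.le hwW hX hY0 (hbd Y hY0 hYb)
      (by positivity) h t).trans ?_
    rw [add_smul, one_smul]
    gcongr
    refine (smul_le_smul_left_of_nonneg (by positivity) (hbd Y hY0 hYb t)).trans (le_of_eq ?_)
    rw [smul_smul]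
    congr 1
    ring
  refine ⟨β / a, by positivity, 1 - w / β, hη, by linarith [div_pos hw hβ0], ?_⟩
  intro X Y hX hXb hY hYb t
  have hX0 := haI.trans hX
  have hY0 := haI.trans hY
  refine norm_sub_le_of_le_add (isHermitian_of_nonneg (compositeRiccati_nonneg hW hV hX0 t))
    (isHermitian_of_nonneg (compositeRiccati_nonneg hW hV hY0 t)) (by positivity)
    (key X Y hX0 hY hYb t) ?_
  have := key Y X hY0 hX hXb t
  rwa [norm_sub_rev] at this

end Composite

/-! ### The period map and its fixed point. -/

section Periodic

variable {n p M : ℕ} {A W : Matrix (Fin n) (Fin n) ℝ} {C : Fin M → Matrix (Fin p) (Fin n) ℝ}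
  {V : Fin M → Matrix (Fin p) (Fin p) ℝ} {σ : ℕ → Fin M} {N : ℕ}

theorem exists_contraction_iterate (hW : W.PosDef) (hV : ∀ i, (V i).PosDef)
    (hσ : IsFeasible A W C V σ) (hN : 1 ≤ N) (hper : ∀ t, σ t = σ (t + N)) {a : ℝ} (ha : 0 < a)
    (b : ℝ) :
    ∃ c > 0, ∃ η : ℝ, 0 < η ∧ η < 1 ∧ ∀ X Y : Matrix (Fin n) (Fin n) ℝ,
      a • 1 ≤ X → X ≤ b • 1 → a • 1 ≤ Y → Y ≤ b • 1 → ∀ k : ℕ,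
        dist ((compositeRiccati A W C V σ N)^[k] X) ((compositeRiccati A W C V σ N)^[k] Y) ≤
          c * η ^ k * dist X Y := by
  obtain ⟨c, hc, η, hη0, hη1, h⟩ := exists_contraction hW hV hσ ha b
  refine ⟨c, hc, η ^ N, by positivity, pow_lt_one₀ hη0.le hη1 (by omega), ?_⟩
  intro X Y h₁ h₂ h₃ h₄ k
  rw [iterate_compositeRiccati hper, iterate_compositeRiccati hper, dist_eq_norm, dist_eq_norm,
    ← pow_mul, mul_comm N]
  exact h X Y h₁ h₂ h₃ h₄ (k * N)

/-- A Hermitian matrix close to one in `[a I, b I]` lies in `[(a - r) I, (b + r) I]`. -/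
theorem mem_enlarged_interval {X Y : Matrix (Fin n) (Fin n) ℝ} {a b r : ℝ} (hX : X.IsHermitian)
    (hY : Y.IsHermitian) (ha : a • 1 ≤ Y) (hb : Y ≤ b • 1) (h : dist X Y ≤ r) :
    (a - r) • 1 ≤ X ∧ X ≤ (b + r) • 1 := by
  rw [dist_eq_norm] at h
  have hr := smul_le_smul_right_of_le h (one_nonneg_loewner (n := Fin n))
  constructor
  · rw [sub_smul, sub_le_iff_le_add]
    refine (ha.trans (le_add_norm_smul_one hY hX)).trans ?_
    rw [norm_sub_rev]
    gcongr
  · rw [add_smul]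
    refine (le_add_norm_smul_one hX hY).trans ?_
    gcongr

theorem exists_fixedPoint (hW : W.PosDef) (hV : ∀ i, (V i).PosDef)
    (hσ : IsFeasible A W C V σ) (hN : 1 ≤ N) (hper : ∀ t, σ t = σ (t + N)) :
    ∃ P : Matrix (Fin n) (Fin n) ℝ, 0 ≤ P ∧ compositeRiccati A W C V σ N P = P := by
  set F := compositeRiccati A W C V σ N with hF
  obtain ⟨w, hw, hwW⟩ := exists_pos_smul_one_le hW
  obtain ⟨β, hβ⟩ := hσ 0 Matrix.PosSemidef.zero
  -- Starting at `F 0` rather than `0` puts every term above `w I`.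
  set x : ℕ → Matrix (Fin n) (Fin n) ℝ := fun k => F^[k] (F 0) with hx
  have hx_eq : ∀ k, x k = compositeRiccati A W C V σ ((k + 1) * N) 0 := fun k => by
    rw [← iterate_compositeRiccati hper, Function.iterate_succ_apply]
  have hlow : ∀ k, w • 1 ≤ x k := fun k => hwW.trans <| by
    rw [hx_eq]
    exact le_compositeRiccati hW hV le_rfl (Nat.mul_pos k.succ_pos hN)
  have hupp : ∀ k, x k ≤ β • 1 := fun k => by
    rw [hx_eq]
    exact hβ _
  have hwI : (0 : Matrix (Fin n) (Fin n) ℝ) ≤ w • 1 := by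
    simpa using smul_le_smul_left_of_nonneg hw.le one_nonneg_loewner
  have hherm : ∀ k, (x k).IsHermitian := fun k => isHermitian_of_nonneg (hwI.trans (hlow k))
  have hsucc : ∀ k, F (x k) = x (k + 1) := fun k => (Function.iterate_succ_apply' F k _).symm
  -- The interval is widened by `w / 2` so that the limit, known only to be near the orbit, also
  -- lies in it.
  obtain ⟨c, hc, η, hη0, hη1, hcon⟩ := exists_contraction_iterate hW hV hσ hN hper
    (half_pos hw) (β + w / 2)
  have hlow' : ∀ k, (w / 2) • 1 ≤ x k := fun k =>
    (smul_le_smul_right_of_le (half_le_self hw.le) one_nonneg_loewner).trans (hlow k)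
  have hupp' : ∀ k, x k ≤ (β + w / 2) • 1 := fun k =>
    (hupp k).trans (smul_le_smul_right_of_le (by linarith) one_nonneg_loewner)
  have hcauchy : CauchySeq x := by
    refine cauchySeq_of_le_geometric η (c * dist (x 0) (x 1)) hη1 fun k => ?_
    have := hcon (x 0) (x 1) (hlow' 0) (hupp' 0) (hlow' 1) (hupp' 1) k
    have h1 : F^[k] (x 1) = x (k + 1) := by
      rw [← hsucc 0, ← Function.iterate_succ_apply]
      rfl
    rw [h1] at this
    exact this.trans_eq (by ring)
  obtain ⟨P, hP⟩ := cauchySeq_tendsto_of_complete hcauchy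
  have hPh : P.IsHermitian := by
    refine tendsto_nhds_unique ?_ hP
    have := ((continuous_id.matrix_conjTranspose).tendsto P).comp hP
    exact this.congr fun k => hherm k
  have hdist : Tendsto (fun k => dist (x k) P) atTop (𝓝 0) := tendsto_iff_dist_tendsto_zero.1 hP
  obtain ⟨k₀, hk₀⟩ := (hdist.eventually (gt_mem_nhds (half_pos hw))).exists
  have hPint := mem_enlarged_interval hPh (hherm k₀) (hlow k₀) (hupp k₀)
    ((dist_comm _ _).trans_le hk₀.le)
  rw [sub_half] at hPint
  refine ⟨P, ?_, ?_⟩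
  · refine le_trans ?_ hPint.1
    simpa using smul_le_smul_left_of_nonneg (half_pos hw).le (one_nonneg_loewner (n := Fin n))
  -- The contraction estimate for one iterate replaces continuity of `F` at `P`.
  · have hlim : Tendsto (fun k => dist (x (k + 1)) (F P)) atTop (𝓝 0) := by
      refine squeeze_zero (fun _ => dist_nonneg) (fun k => ?_)
        (by simpa using hdist.const_mul (c * η ^ 1))
      have := hcon (x k) P (hlow' k) (hupp' k) hPint.1 hPint.2 1
      rwa [Function.iterate_one, ← hF, hsucc] at this
    exact tendsto_nhds_unique (tendsto_iff_dist_tendsto_zero.2 hlim)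
      ((tendsto_add_atTop_iff_nat 1).2 hP)

end Periodic

end SensorScheduling

/-! ### Stability of the fixed point. -/

open SensorScheduling in
open scoped MatrixOrder in
theorem mainTheorem8 {n p M : ℕ}
    (A W : Matrix (Fin n) (Fin n) ℝ)
    (C : Fin M → Matrix (Fin p) (Fin n) ℝ)
    (V : Fin M → Matrix (Fin p) (Fin p) ℝ)
    (hW : W.PosDef) (hV : ∀ i, (V i).PosDef)
    (σ : ℕ → Fin M)
    (hσ : SensorScheduling.IsFeasible A W C V σ)
    (N : ℕ) (hN : 1 ≤ N) (hper : ∀ t : ℕ, σ t = σ (t + N)) :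
    ∃ P : Matrix (Fin n) (Fin n) ℝ,
      SensorScheduling.IsGloballyAsymptoticallyStable
        (SensorScheduling.compositeRiccati A W C V σ N) (SensorScheduling.psdCone n) P ∧
      SensorScheduling.IsLocallyExponentiallyStable
        (SensorScheduling.compositeRiccati A W C V σ N) (SensorScheduling.psdCone n) P := by
  set F := compositeRiccati A W C V σ N with hF
  obtain ⟨P, hP0, hPF⟩ := exists_fixedPoint hW hV hσ hN hper
  obtain ⟨w, hw, hwW⟩ := exists_pos_smul_one_le hW
  obtain ⟨β, hβ⟩ := hσ P (Matrix.nonneg_iff_posSemidef.1 hP0)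
  have hmaps : Set.MapsTo F (psdCone n) (psdCone n) := fun x hx =>
    Matrix.nonneg_iff_posSemidef.1
      (compositeRiccati_nonneg hW hV (Matrix.nonneg_iff_posSemidef.2 hx) N)
  have hPβ : P ≤ β • 1 := hβ 0
  have hwP : w • 1 ≤ P := by
    rw [← hPF]
    exact hwW.trans (le_compositeRiccati hW hV hP0 hN)
  have hFP : ∀ k, F^[k] P = P := Function.iterate_fixed hPF
  -- As `P ≥ w I`, the radius `w / 2` keeps nearby states above `(w / 2) I`.
  have hexp : ∃ c > 0, ∃ η : ℝ, 0 < η ∧ η < 1 ∧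
      ∀ x ∈ psdCone n, dist x P < w / 2 → ∀ k : ℕ, dist (F^[k] x) P ≤ c * η ^ k * dist x P := by
    obtain ⟨c, hc, η, hη0, hη1, h⟩ := exists_contraction_iterate hW hV hσ hN hper
      (half_pos hw) (β + w / 2)
    refine ⟨c, hc, η, hη0, hη1, fun x hx hxP k => ?_⟩
    have hxI := mem_enlarged_interval hx.isHermitian (isHermitian_of_nonneg hP0) hwP hPβ hxP.le
    rw [sub_half] at hxI
    have := h x P hxI.1 hxI.2
      ((smul_le_smul_right_of_le (half_le_self hw.le) one_nonneg_loewner).trans hwP)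
      (hPβ.trans (smul_le_smul_right_of_le (by linarith) one_nonneg_loewner)) k
    rwa [← hF, hFP] at this
  obtain ⟨c, hc, η, hη0, hη1, hcη⟩ := hexp
  refine ⟨P, ⟨hmaps, Matrix.nonneg_iff_posSemidef.1 hP0, hPF, ?_, ?_⟩,
    ⟨hmaps, Matrix.nonneg_iff_posSemidef.1 hP0, hPF,
      w / 2, half_pos hw, c, hc, η, hη0, hη1, hcη⟩⟩
  · intro ε hε
    refine ⟨min (w / 2) (ε / c), lt_min (half_pos hw) (div_pos hε hc), fun x hx hxP k => ?_⟩
    calc dist (F^[k] x) P ≤ c * η ^ k * dist x P := hcη x hx (hxP.trans_le (min_le_left _ _)) k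
      _ ≤ c * 1 * dist x P := by
          gcongr
          exact pow_le_one₀ hη0.le hη1.le
      _ < ε := by
          rw [mul_one, mul_comm]
          exact (lt_div_iff₀ hc).1 (hxP.trans_le (min_le_right _ _))
  · intro x hx
    obtain ⟨b, hb⟩ := hσ x hx
    obtain ⟨c', -, η', hη0', hη1', h⟩ := exists_contraction_iterate hW hV hσ hN hper
      hw (max b β)
    -- The initial state may be singular, so the comparison starts from `F x`, which is at least `w
    -- I`.
    have hlim : Tendsto (fun k => dist (F^[k + 1] x) P) atTop (𝓝 0) := by
      refine squeeze_zero (fun _ => dist_nonneg) (fun k => ?_)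
        (by simpa using ((tendsto_pow_atTop_nhds_zero_of_lt_one hη0'.le hη1').const_mul
          c').mul_const (dist (F x) P))
      have := h (F x) P
        (hwW.trans (le_compositeRiccati hW hV (Matrix.nonneg_iff_posSemidef.2 hx) hN))
        (le_trans (hb N) (smul_le_smul_right_of_le (le_max_left _ _) one_nonneg_loewner))
        hwP (hPβ.trans (smul_le_smul_right_of_le (le_max_right _ _) one_nonneg_loewner)) k
      rwa [← hF, hFP, ← Function.iterate_succ_apply] at this
    exact (tendsto_add_atTop_iff_nat 1).1 (tendsto_iff_dist_tendsto_zero.2 hlim)
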